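/- A (generalised) triangulation of dimension $d$ consists of finitely many abstract $d$-simplices together with a set of gluings. Each gluing affinely identifies two distinct $(d-1)$-faces (possibly of the same simplex) by a bijection of their vertices, and each $(d-1)$-face is used in at most one gluing. Its underlying space is the resulting quotient space; $f_k$ denotes the number of its $k$-dimensional faces after identification, and the $d$-faces are called facets. The pillow of dimension $d$ is the triangulation consisting of two $d$-simplices glued along their boundaries by the identity map. A $0$-$2$ vertex move opens up one gluing and inserts, in the place of the glued $(d-1)$-face, two new $d$-simplices that are identified with each other, by the identity, along $d$ of their $d+1$ boundary faces. Proposition. Let $d \geq 1$ and $f_d \geq 2$ be integers with $f_d$ even and, if $d = 1$, with $f_d = 2$. Then there exists a triangulation of the $d$-sphere (that is, one whose underlying space is homeomorphic to $S^d$ and, moreover, PL homeomorphic to the boundary of the $(d+1)$-simplex) with exactly $f_d$ facets and exactly $f_0 = \frac{f_d}{2} + d$ vertices, and which is obtained, up to combinatorial equivalence, from the pillow of dimension $d$ by a finite (possibly empty) sequence of $0$-$2$ vertex moves. -/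

import Mathlib

/-- A (finite, generalised) triangulation of dimension `d`: finitely many abstract `d`-simplices,
each with vertices labelled by `Fin (d + 1)`, together with gluings of some of their
`(d - 1)`-faces in pairs.

The pair `(σ, i)` stands for the `(d - 1)`-face of the simplex `σ` opposite to its vertex `i`.
`glue (σ, i) = none` means that this face is not used in a gluing, and
`glue (σ, i) = some ((τ, j), π)` means that it is glued to the face `(τ, j)` by the affine map
taking the vertex `v ≠ i` of `σ` to the vertex `π v` of `τ`. The value `π i` carries no
information and is normalised to be `j`. -/
structure GenTriangulation (d : ℕ) where
  /-- the abstract `d`-simplices -/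
  Simplex : Type
  [fintypeSimplex : Fintype Simplex]
  /-- the gluings -/
  glue : Simplex × Fin (d + 1) →
    Option ((Simplex × Fin (d + 1)) × Equiv.Perm (Fin (d + 1)))
  /-- `π` takes the glued face onto its partner -/
  glue_opposite : ∀ r r' π, glue r = some (r', π) → π r.2 = r'.2
  /-- no face is glued to itself -/
  glue_ne_self : ∀ r r' π, glue r = some (r', π) → r' ≠ r
  /-- a gluing is an unordered pair of faces -/
  glue_symm : ∀ r r' π, glue r = some (r', π) → glue r' = some (r, π⁻¹)

namespace GenTriangulation

variable {d : ℕ}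

attribute [instance] GenTriangulation.fintypeSimplex

/-! ### Faces and face numbers -/

/-- The `k`-faces of the abstract simplices, before gluing: a simplex and `k + 1` of its
vertices. -/
abbrev RawFace (T : GenTriangulation d) (k : ℕ) : Type :=
  T.Simplex × {s : Finset (Fin (d + 1)) // s.card = k + 1}

/-- Two `k`-faces of abstract simplices are matched by a single gluing. -/
def FaceGlued (T : GenTriangulation d) (k : ℕ) (a b : T.RawFace k) : Prop :=
  ∃ (i j : Fin (d + 1)) (π : Equiv.Perm (Fin (d + 1))),
    T.glue (a.1, i) = some ((b.1, j), π) ∧ i ∉ a.2.1 ∧ b.2.1 = a.2.1.map π.toEmbedding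

/-- The `k`-faces of a triangulation: the `k`-faces of the abstract simplices up to the
equivalence relation generated by the gluings. -/
def Face (T : GenTriangulation d) (k : ℕ) : Type := Quot (T.FaceGlued k)

/-- The entry `f_k` of the face vector. -/
noncomputable def faceNumber (T : GenTriangulation d) (k : ℕ) : ℕ := Nat.card (T.Face k)

/-! ### The underlying space -/

/-- Two points of the disjoint union of the simplices (in barycentric coordinates) are
identified by a single gluing. -/
def PointGlued (T : GenTriangulation d)
    (p q : Σ _ : T.Simplex, stdSimplex ℝ (Fin (d + 1))) : Prop :=
  ∃ (i j : Fin (d + 1)) (π : Equiv.Perm (Fin (d + 1))),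
    T.glue (p.1, i) = some ((q.1, j), π) ∧ p.2.1 i = 0 ∧ ∀ v, q.2.1 (π v) = p.2.1 v

/-- The underlying space `|T|`: the disjoint union of the simplices modulo the equivalence
relation generated by the gluings, with the quotient topology. -/
def Space (T : GenTriangulation d) : Type := Quot T.PointGlued

instance (T : GenTriangulation d) : TopologicalSpace T.Space :=
  inferInstanceAs (TopologicalSpace (Quot T.PointGlued))

/-- The characteristic map of a facet. -/
def charMap (T : GenTriangulation d) (σ : T.Simplex) (x : stdSimplex ℝ (Fin (d + 1))) : T.Space :=
  Quot.mk T.PointGlued ⟨σ, x⟩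

/-- A piecewise linear map from the standard simplex to `ℝⁿ`: a continuous map such that the
simplex is a finite union of sets on each of which the map is affine. (By continuity, these sets
may be taken to be the closed cells cut out by the finitely many hyperplanes along which coordinates
of two of the affine maps agree.) -/
def IsPiecewiseLinear {m n : ℕ} (g : stdSimplex ℝ (Fin m) → (Fin n → ℝ)) : Prop :=
  Continuous g ∧ ∃ A : Finset ((Fin m → ℝ) →ᵃ[ℝ] (Fin n → ℝ)), ∀ x, ∃ a ∈ A, g x = a x.1

/-- The standard PL `d`-sphere: the boundary of the standard `(d + 1)`-simplex. -/
def simplexBoundary (d : ℕ) : Set (Fin (d + 2) → ℝ) :=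
  {x | x ∈ stdSimplex ℝ (Fin (d + 2)) ∧ ∃ i, x i = 0}

/-- `|T|` is a PL `d`-sphere: there is a homeomorphism from `|T|` onto the boundary of the
`(d + 1)`-simplex that is piecewise linear on every facet of `T`. -/
def IsPLSphere (T : GenTriangulation d) : Prop :=
  ∃ h : T.Space ≃ₜ simplexBoundary d,
    ∀ σ : T.Simplex, IsPiecewiseLinear fun x => (h (T.charMap σ x) : Fin (d + 2) → ℝ)

/-- `T` is a triangulation of the `d`-sphere: `|T|` is homeomorphic to the unit sphere of
`ℝ^(d+1)`, and it is also PL homeomorphic to the standard PL sphere. -/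
def TriangulatesSphere (T : GenTriangulation d) : Prop :=
  Nonempty (T.Space ≃ₜ Metric.sphere (0 : EuclideanSpace ℝ (Fin (d + 1))) 1) ∧ T.IsPLSphere

/-! ### The pillow and the 0-2 vertex move -/

/-- A combinatorial equivalence of triangulations: a bijection of simplices with relabellings of
their vertices that respects the gluings. -/
structure Iso (T U : GenTriangulation d) where
  /-- the bijection of the simplices -/
  toEquiv : T.Simplex ≃ U.Simplex
  /-- the relabelling of the vertices of each simplex -/
  label : T.Simplex → Equiv.Perm (Fin (d + 1))
  /-- gluings correspond to gluings -/
  glue_eq : ∀ (σ : T.Simplex) (i : Fin (d + 1)),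
    U.glue (toEquiv σ, label σ i) = (T.glue (σ, i)).map fun g =>
      ((toEquiv g.1.1, label g.1.1 g.1.2), label g.1.1 * g.2 * (label σ)⁻¹)

/-- The pillow: two `d`-simplices glued along their boundaries by the identity map. -/
def pillow (d : ℕ) : GenTriangulation d where
  Simplex := Bool
  glue r := some ((!r.1, r.2), 1)
  glue_opposite := by
    rintro ⟨b, i⟩ r' π h
    simp only [Option.some.injEq, Prod.mk.injEq] at h
    obtain ⟨rfl, rfl⟩ := h
    rfl
  glue_ne_self := by
    rintro ⟨b, i⟩ r' π h
    simp only [Option.some.injEq, Prod.mk.injEq] at h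
    obtain ⟨rfl, rfl⟩ := h
    simp
  glue_symm := by
    rintro ⟨b, i⟩ r' π h
    simp only [Option.some.injEq, Prod.mk.injEq] at h
    obtain ⟨rfl, rfl⟩ := h
    simp

open Classical in
/-- The gluings after the 0-2 vertex move at the ridge formed by gluing the face `r` to the face
`r'` by `π`. The two new simplices `inr false` and `inr true` are glued to one another by the
identity along the `d` faces that contain their vertex `r.2`, which becomes a new interior vertex;
of the remaining two faces, the one of `inr false` is glued to `r` and the one of `inr true` is
glued to `r'`. All other gluings are kept. -/
noncomputable def zeroTwoGlue (T : GenTriangulation d) (r r' : T.Simplex × Fin (d + 1))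
    (π : Equiv.Perm (Fin (d + 1))) :
    (T.Simplex ⊕ Bool) × Fin (d + 1) →
      Option (((T.Simplex ⊕ Bool) × Fin (d + 1)) × Equiv.Perm (Fin (d + 1)))
  | (Sum.inl σ, i) =>
      if (σ, i) = r then some ((Sum.inr false, r.2), 1)
      else if (σ, i) = r' then some ((Sum.inr true, r.2), π⁻¹)
      else (T.glue (σ, i)).map fun g => ((Sum.inl g.1.1, g.1.2), g.2)
  | (Sum.inr false, i) =>
      if i = r.2 then some ((Sum.inl r.1, r.2), 1) else some ((Sum.inr true, i), 1)
  | (Sum.inr true, i) =>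
      if i = r.2 then some ((Sum.inl r'.1, r'.2), π) else some ((Sum.inr false, i), 1)

/-- The triangulation obtained from `T` by the 0-2 vertex move at the ridge formed by gluing the
face `r` to the face `r'` by `π`: the ridge is opened up and two simplices, identified along `d` of
their boundary faces (a pillow with a vertex inside), are inserted in its place. -/
noncomputable def zeroTwoMove (T : GenTriangulation d) (r r' : T.Simplex × Fin (d + 1))
    (π : Equiv.Perm (Fin (d + 1))) (h : T.glue r = some (r', π)) : GenTriangulation d where
  Simplex := T.Simplex ⊕ Bool
  glue := T.zeroTwoGlue r r' π
  glue_opposite := by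
    rintro ⟨σ | _ | _, i⟩ s ρ hs <;> simp only [zeroTwoGlue] at hs <;> split_ifs at hs with h1 h2
    · obtain ⟨rfl, rfl⟩ := by simpa using hs
      simp [← h1]
    · obtain ⟨rfl, rfl⟩ := by simpa using hs
      have := T.glue_opposite r r' π h
      rw [← h2] at this
      simp [Equiv.symm_apply_eq, this]
    · obtain ⟨⟨t, κ⟩, ht, hs⟩ := Option.map_eq_some_iff.1 hs
      obtain ⟨rfl, rfl⟩ := by simpa using hs
      exact T.glue_opposite _ _ _ ht
    · obtain ⟨rfl, rfl⟩ := by simpa using hs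
      simpa using h1
    · obtain ⟨rfl, rfl⟩ := by simpa using hs
      simp
    · obtain ⟨rfl, rfl⟩ := by simpa using hs
      simpa [h1] using T.glue_opposite r r' π h
    · obtain ⟨rfl, rfl⟩ := by simpa using hs
      simp
  glue_ne_self := by
    rintro ⟨σ | _ | _, i⟩ s ρ hs <;> simp only [zeroTwoGlue] at hs <;> split_ifs at hs with h1 h2
    · obtain ⟨rfl, rfl⟩ := by simpa using hs
      simp
    · obtain ⟨rfl, rfl⟩ := by simpa using hs
      simp
    · obtain ⟨⟨t, κ⟩, ht, hs⟩ := Option.map_eq_some_iff.1 hs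
      obtain ⟨rfl, rfl⟩ := by simpa using hs
      have := T.glue_ne_self _ _ _ ht
      simpa [Prod.ext_iff] using this
    all_goals
      obtain ⟨rfl, rfl⟩ := by simpa using hs
      simp
  glue_symm := by
    rintro ⟨σ | _ | _, i⟩ s ρ hs <;> simp only [zeroTwoGlue] at hs <;> split_ifs at hs with h1 h2
    · obtain ⟨rfl, rfl⟩ := by simpa using hs
      simp [zeroTwoGlue, ← h1]
    · obtain ⟨rfl, rfl⟩ := by simpa using hs
      simp [zeroTwoGlue, ← h2]
    · obtain ⟨⟨t, κ⟩, ht, hs⟩ := Option.map_eq_some_iff.1 hs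
      obtain ⟨rfl, rfl⟩ := by simpa using hs
      have hback := T.glue_symm _ _ _ ht
      have e1 : t ≠ r := by
        rintro rfl
        rw [h] at hback
        simp only [Option.some.injEq, Prod.mk.injEq] at hback
        exact h2 hback.1.symm
      have e2 : t ≠ r' := by
        rintro rfl
        rw [T.glue_symm _ _ _ h] at hback
        simp only [Option.some.injEq, Prod.mk.injEq] at hback
        exact h1 hback.1.symm
      simp [zeroTwoGlue, e1, e2, hback]
    · obtain ⟨rfl, rfl⟩ := by simpa using hs
      simp [zeroTwoGlue, h1]
    · obtain ⟨rfl, rfl⟩ := by simpa using hs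
      simp [zeroTwoGlue, h1]
    · obtain ⟨rfl, rfl⟩ := by simpa using hs
      simp [zeroTwoGlue, h1, T.glue_ne_self _ _ _ h]
    · obtain ⟨rfl, rfl⟩ := by simpa using hs
      simp [zeroTwoGlue, h1]

/-- `U` arises from `T` by a single 0-2 vertex move, up to combinatorial equivalence. -/
def IsZeroTwoMove (T U : GenTriangulation d) : Prop :=
  ∃ (r r' : T.Simplex × Fin (d + 1)) (π : Equiv.Perm (Fin (d + 1)))
    (h : T.glue r = some (r', π)), Nonempty (Iso (T.zeroTwoMove r r' π h) U)

end GenTriangulation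

/-! Starting from the pillow, always perform the move at one face opposite to the vertex `0`. The
result is a cycle of `2 * n + 2` simplices with identity gluings, in which consecutive simplices
share alternately all faces containing the vertex `0` and the single face opposite to it;
`CyclicArrangement` records this, and `exists_isZeroTwoMove` is the induction step.

Vertices: each of the `n + 1` pairs glued along the faces containing the vertex `0` has its own
vertex `0`, while the other `d` vertices are common to the whole cycle (`faceNumber_zero`). With `f
= 2 * n + 2` this gives `f / 2 + d`.

Sphere: subtracting the least of the coordinates other than the `0`-th exhibits a simplex as the
join of `∂Δ^(d-1)` with the segment from the barycentre of the face opposite to `0` (weight `u = d *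
low x`) to the vertex `0` (weight `t = x 0`). The gluings fix `∂Δ^(d-1)` and join the segments end
to end: at `u = 0` across a face containing the vertex `0`, at `t = 0` across the opposite one. So
the space is the join of `∂Δ^(d-1)` with a polygon. The boundary of the `(d + 1)`-simplex is
likewise the join of `∂Δ^(d-1)` with the boundary of a triangle `azb`, where `a`, `z` are two
vertices and `b` is the barycentre of the face spanned by the others. A piecewise linear
homeomorphism from the polygon to this triangle, extended by the identity of `∂Δ^(d-1)`, is
`spherePoint`; `charMap_eq_of_spherePoint_eq` and `exists_spherePoint_eq` give bijectivity, and
compactness does the rest. -/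

namespace GenTriangulation

variable {d : ℕ}

/-! ### Piecewise linear functions -/

/-- A real-valued piecewise linear function on the standard simplex. -/
def IsPLFun {m : ℕ} (f : stdSimplex ℝ (Fin m) → ℝ) : Prop :=
  Continuous f ∧ ∃ A : Set ((Fin m → ℝ) →ᵃ[ℝ] ℝ), A.Finite ∧ ∀ x, ∃ a ∈ A, f x = a x.1

namespace IsPLFun

variable {m : ℕ} {f g : stdSimplex ℝ (Fin m) → ℝ}

theorem coord (i : Fin m) : IsPLFun fun x : stdSimplex ℝ (Fin m) => x.1 i :=
  ⟨(continuous_apply i).comp continuous_subtype_val,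
    {(LinearMap.proj i : (Fin m → ℝ) →ₗ[ℝ] ℝ).toAffineMap}, Set.finite_singleton _,
    fun _ => ⟨_, rfl, rfl⟩⟩

theorem zero : IsPLFun fun _ : stdSimplex ℝ (Fin m) => (0 : ℝ) :=
  ⟨continuous_const, {0}, Set.finite_singleton _, fun _ => ⟨0, rfl, rfl⟩⟩

theorem add (hf : IsPLFun f) (hg : IsPLFun g) : IsPLFun fun x => f x + g x := by
  obtain ⟨hf, A, hA, hfA⟩ := hf
  obtain ⟨hg, B, hB, hgB⟩ := hg
  refine ⟨hf.add hg, Set.image2 (· + ·) A B, hA.image2 _ hB, fun x => ?_⟩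
  obtain ⟨a, ha, hax⟩ := hfA x
  obtain ⟨b, hb, hbx⟩ := hgB x
  exact ⟨a + b, Set.mem_image2_of_mem ha hb, by simp [hax, hbx]⟩

theorem const_mul (c : ℝ) (hf : IsPLFun f) : IsPLFun fun x => c * f x := by
  obtain ⟨hf, A, hA, hfA⟩ := hf
  refine ⟨continuous_const.mul hf, (c • ·) '' A, hA.image _, fun x => ?_⟩
  obtain ⟨a, ha, hax⟩ := hfA x
  exact ⟨c • a, Set.mem_image_of_mem _ ha, by simp [hax]⟩

theorem sub (hf : IsPLFun f) (hg : IsPLFun g) : IsPLFun fun x => f x - g x := by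
  convert hf.add (hg.const_mul (-1)) using 2
  ring

theorem max (hf : IsPLFun f) (hg : IsPLFun g) : IsPLFun fun x => max (f x) (g x) := by
  obtain ⟨hf, A, hA, hfA⟩ := hf
  obtain ⟨hg, B, hB, hgB⟩ := hg
  refine ⟨hf.max hg, A ∪ B, hA.union hB, fun x => ?_⟩
  rcases max_choice (f x) (g x) with h | h
  · obtain ⟨a, ha, hax⟩ := hfA x
    exact ⟨a, Or.inl ha, h.trans hax⟩
  · obtain ⟨b, hb, hbx⟩ := hgB x
    exact ⟨b, Or.inr hb, h.trans hbx⟩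

theorem inf' {ι : Type*} {s : Finset ι} (hs : s.Nonempty)
    {F : ι → stdSimplex ℝ (Fin m) → ℝ} (hF : ∀ i, IsPLFun (F i)) :
    IsPLFun fun x => s.inf' hs fun i => F i x := by
  choose hc A hA hFA using hF
  refine ⟨Continuous.finset_inf'_apply hs fun i _ => hc i, ⋃ i ∈ s, A i,
    s.finite_toSet.biUnion fun i _ => hA i, fun x => ?_⟩
  obtain ⟨i, hi, hx⟩ := s.exists_mem_eq_inf' hs fun i => F i x
  obtain ⟨a, ha, hax⟩ := hFA i x
  exact ⟨a, Set.mem_biUnion hi ha, hx.trans hax⟩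

theorem isPiecewiseLinear {n : ℕ} {G : stdSimplex ℝ (Fin m) → Fin n → ℝ}
    (hG : ∀ j, IsPLFun fun x => G x j) : IsPiecewiseLinear G := by
  choose hc A hA hGA using hG
  refine ⟨continuous_pi hc,
    ((Set.Finite.pi' hA).image fun a => AffineMap.pi a).toFinset, fun x => ?_⟩
  choose a ha hax using fun j => hGA j x
  refine ⟨AffineMap.pi a, by simpa using ⟨a, ha, rfl⟩, ?_⟩
  ext j
  simpa using hax j

end IsPLFun

/-! ### The boundary of the simplex is a topological sphere -/

/-- The least entry of a vector. -/
noncomputable def least {m : ℕ} [NeZero m] (x : Fin m → ℝ) : ℝ :=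
  Finset.univ.inf' Finset.univ_nonempty x

section least

variable {m : ℕ} [NeZero m] {x : Fin m → ℝ}

theorem least_le (x : Fin m → ℝ) (i : Fin m) : least x ≤ x i :=
  Finset.inf'_le _ (Finset.mem_univ i)

theorem exists_eq_least (x : Fin m → ℝ) : ∃ i, x i = least x := by
  obtain ⟨i, -, h⟩ := Finset.univ.exists_mem_eq_inf' Finset.univ_nonempty x
  exact ⟨i, h.symm⟩

theorem least_eq {c : ℝ} (h : ∀ i, c ≤ x i) (i : Fin m) (hi : x i = c) : least x = c :=
  le_antisymm ((least_le x i).trans hi.le) (Finset.le_inf' _ _ fun i _ => h i)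

theorem least_sub_add (x : Fin m → ℝ) (a b : ℝ) :
    least (fun i => x i - a + b) = least x - a + b := by
  obtain ⟨i, hi⟩ := exists_eq_least x
  exact least_eq (fun j => by linarith [least_le x j]) i (by rw [hi])

theorem least_smul {c : ℝ} (hc : 0 ≤ c) (x : Fin m → ℝ) : least (c • x) = c * least x := by
  obtain ⟨i, hi⟩ := exists_eq_least x
  exact least_eq (fun j => mul_le_mul_of_nonneg_left (least_le x j) hc) i (by simp [hi])

theorem continuous_least : Continuous (least : (Fin m → ℝ) → ℝ) :=
  Continuous.finset_inf'_apply _ fun i _ => continuous_apply i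

end least

/-- A vector translated along the diagonal so as to have least entry zero. -/
noncomputable def lowered (v : EuclideanSpace ℝ (Fin (d + 1))) (i : Fin (d + 2)) : ℝ :=
  (Fin.cons 0 v.ofLp : Fin (d + 2) → ℝ) i - least (Fin.cons 0 v.ofLp : Fin (d + 2) → ℝ)

theorem lowered_nonneg (v : EuclideanSpace ℝ (Fin (d + 1))) (i : Fin (d + 2)) :
    0 ≤ lowered v i :=
  sub_nonneg.2 (least_le _ i)

theorem lowered_smul {c : ℝ} (hc : 0 ≤ c) (v : EuclideanSpace ℝ (Fin (d + 1))) :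
    lowered (c • v) = c • lowered v := by
  have h : (Fin.cons 0 (c • v).ofLp : Fin (d + 2) → ℝ) = c • Fin.cons 0 v.ofLp := by
    ext i
    cases i using Fin.cases <;> simp
  ext i
  rw [lowered, h, least_smul hc, Pi.smul_apply, Pi.smul_apply, lowered, smul_eq_mul, smul_eq_mul,
    mul_sub]

theorem lowered_succ_sub (v : EuclideanSpace ℝ (Fin (d + 1))) (i : Fin (d + 1)) :
    lowered v i.succ - lowered v 0 = v i := by
  simp [lowered]

/-- Nonnegative entries with zero sum all vanish, and the entries of `v` are differences of them. -/
theorem lowered_sum_pos {v : EuclideanSpace ℝ (Fin (d + 1))} (hv : v ≠ 0) :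
    0 < ∑ i, lowered v i := by
  refine (Finset.sum_nonneg fun i _ => lowered_nonneg v i).lt_of_ne fun h => hv ?_
  have h0 := (Finset.sum_eq_zero_iff_of_nonneg fun i _ => lowered_nonneg v i).1 h.symm
  ext i
  rw [← lowered_succ_sub, h0 _ (Finset.mem_univ _), h0 _ (Finset.mem_univ _)]
  simp

theorem continuous_lowered :
    Continuous (lowered : EuclideanSpace ℝ (Fin (d + 1)) → Fin (d + 2) → ℝ) := by
  have h : Continuous fun v : EuclideanSpace ℝ (Fin (d + 1)) =>
      (Fin.cons 0 v.ofLp : Fin (d + 2) → ℝ) := by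
    refine continuous_pi fun i => ?_
    cases i using Fin.cases <;> simp <;> fun_prop
  exact continuous_pi fun i => ((continuous_apply i).comp h).sub (continuous_least.comp h)

/-- The radial projection of the unit sphere onto the boundary of the simplex. -/
noncomputable def sphereToBoundary (v : Metric.sphere (0 : EuclideanSpace ℝ (Fin (d + 1))) 1) :
    simplexBoundary d :=
  ⟨(∑ i, lowered v.1 i)⁻¹ • lowered v.1, by
    have hpos := lowered_sum_pos (ne_zero_of_mem_unit_sphere v)
    refine ⟨⟨fun i => ?_, ?_⟩, ?_⟩
    · exact mul_nonneg (inv_nonneg.2 hpos.le) (lowered_nonneg _ i)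
    · simp [← Finset.mul_sum, hpos.ne']
    · obtain ⟨i, hi⟩ := exists_eq_least (Fin.cons 0 v.1.ofLp : Fin (d + 2) → ℝ)
      exact ⟨i, by simp [lowered, hi]⟩⟩

theorem continuous_sphereToBoundary : Continuous (sphereToBoundary (d := d)) := by
  have h := continuous_lowered (d := d).comp
    (continuous_subtype_val (p := (· ∈ Metric.sphere (0 : EuclideanSpace ℝ (Fin (d + 1))) 1)))
  have hs : Continuous fun v : Metric.sphere (0 : EuclideanSpace ℝ (Fin (d + 1))) 1 =>
      ∑ i, lowered v.1 i :=
    continuous_finsetSum _ fun i _ => (continuous_apply i).comp h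
  exact Continuous.subtype_mk
    ((hs.inv₀ fun v => (lowered_sum_pos (ne_zero_of_mem_unit_sphere v)).ne').smul h) _

theorem sphereToBoundary_injective : Function.Injective (sphereToBoundary (d := d)) := by
  intro v w h
  have hv := lowered_sum_pos (ne_zero_of_mem_unit_sphere v)
  have hw := lowered_sum_pos (ne_zero_of_mem_unit_sphere w)
  have h := congrArg Subtype.val h
  simp only [sphereToBoundary] at h
  set a := ∑ i, lowered v.1 i
  set b := ∑ i, lowered w.1 i
  -- Differences of coordinates undo the translation along the diagonal, so the two unit vectors lie
  -- on one ray.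
  have hs : a⁻¹ • v.1 = b⁻¹ • w.1 := by
    ext i
    have h1 := congrFun h i.succ
    have h2 := congrFun h 0
    simp only [Pi.smul_apply, smul_eq_mul, PiLp.smul_apply] at h1 h2 ⊢
    rw [← lowered_succ_sub, ← lowered_succ_sub, mul_sub, mul_sub, h1, h2]
  have hn := congrArg norm hs
  rw [norm_smul, norm_smul, norm_eq_of_mem_sphere, norm_eq_of_mem_sphere, mul_one, mul_one,
    Real.norm_of_nonneg (inv_nonneg.2 hv.le), Real.norm_of_nonneg (inv_nonneg.2 hw.le)] at hn
  rw [hn] at hs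
  exact Subtype.ext (smul_right_injective _ (inv_pos.2 hw).ne' hs)

theorem sphereToBoundary_surjective : Function.Surjective (sphereToBoundary (d := d)) := by
  rintro ⟨y, ⟨hy0, hy1⟩, j, hj⟩
  -- Translating `y` to make its `0`-th entry vanish is undone by `lowered`, because a boundary
  -- point already has least entry zero.
  let v : EuclideanSpace ℝ (Fin (d + 1)) := WithLp.toLp 2 fun i => y i.succ - y 0
  have hl : lowered v = y := by
    have hm : least (Fin.cons 0 v.ofLp : Fin (d + 2) → ℝ) = - y 0 := by
      refine least_eq (fun i => ?_) j ?_
      · cases i using Fin.cases <;> simp [v, hy0]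
      · cases j using Fin.cases <;> simp [v, hj]
    ext i
    rw [lowered, hm]
    cases i using Fin.cases <;> simp [v]
  have hv : v ≠ 0 := by
    intro h
    have h0 (i) : y i = y 0 := by
      cases i using Fin.cases with
      | zero => rfl
      | succ i => simpa [v, sub_eq_zero] using congrArg (fun v => v.ofLp i) h
    have : ∑ i, y i = 0 := Finset.sum_eq_zero fun i _ => by rw [h0, ← h0 j, hj]
    linarith
  have hn : 0 < ‖v‖ := norm_pos_iff.2 hv
  refine ⟨⟨‖v‖⁻¹ • v, by simp [norm_smul, hn.ne']⟩, Subtype.ext ?_⟩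
  simp only [sphereToBoundary]
  rw [lowered_smul (inv_nonneg.2 hn.le), hl]
  ext i
  simp [← Finset.mul_sum, hy1, hn.ne']

theorem nonempty_homeomorph_simplexBoundary_sphere (d : ℕ) :
    Nonempty (simplexBoundary d ≃ₜ Metric.sphere (0 : EuclideanSpace ℝ (Fin (d + 1))) 1) :=
  ⟨(Continuous.homeoOfEquivCompactToT2
    (f := Equiv.ofBijective _ ⟨sphereToBoundary_injective, sphereToBoundary_surjective⟩)
    continuous_sphereToBoundary).symm⟩

/-! ### Cyclic triangulations -/

/-- The index of the neighbour of the `k`-th simplex across its face `i`, in a cyclic arrangement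
of `2 * n + 2` simplices in which neighbours share alternately the face opposite to the vertex `0`
and all the other faces. -/
def neighbour (n : ℕ) (i : Fin (d + 1)) (k : ℕ) : ℕ :=
  if i = 0 then
    if Even k then (if k = 0 then 2 * n + 1 else k - 1) else (if k = 2 * n + 1 then 0 else k + 1)
  else if Even k then k + 1 else k - 1

/-- A cyclic arrangement of the simplices of a triangulation, all of whose gluings are identities
and are given by `neighbour`. -/
structure CyclicArrangement (T : GenTriangulation d) (n : ℕ) where
  /-- the index of a simplex -/
  index : T.Simplex → ℕ
  index_injective : Function.Injective index
  exists_index_eq_iff : ∀ k, (∃ σ, index σ = k) ↔ k < 2 * n + 2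
  glue_eq : ∀ σ i, ∃ τ, T.glue (σ, i) = some ((τ, i), 1) ∧ index τ = neighbour n i (index σ)

namespace CyclicArrangement

/-- The pillow is a cyclic arrangement of two simplices. -/
def pillow (d : ℕ) : CyclicArrangement (pillow d) 0 where
  index b := b.toNat
  index_injective := by
    rintro (_ | _) (_ | _) h
    exacts [rfl, absurd h zero_ne_one, absurd h one_ne_zero, rfl]
  exists_index_eq_iff k := by
    constructor
    · rintro ⟨_ | _, rfl⟩ <;> simp
    · intro h
      interval_cases k
      exacts [⟨false, rfl⟩, ⟨true, rfl⟩]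
  glue_eq σ i := ⟨!σ, rfl, by cases σ <;> simp [neighbour]⟩

variable {T : GenTriangulation d} {n : ℕ} (C : CyclicArrangement T n)

include C

theorem index_lt (σ : T.Simplex) : C.index σ < 2 * n + 2 :=
  (C.exists_index_eq_iff _).1 ⟨σ, rfl⟩

theorem glue_of_neighbour {σ τ : T.Simplex} {i : Fin (d + 1)}
    (h : C.index τ = neighbour n i (C.index σ)) : T.glue (σ, i) = some ((τ, i), 1) := by
  obtain ⟨τ', hg, hτ'⟩ := C.glue_eq σ i
  rwa [C.index_injective (h.trans hτ'.symm)]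

theorem eq_of_glue {σ τ : T.Simplex} {i j : Fin (d + 1)} {π : Equiv.Perm (Fin (d + 1))}
    (h : T.glue (σ, i) = some ((τ, j), π)) :
    j = i ∧ π = 1 ∧ C.index τ = neighbour n i (C.index σ) := by
  obtain ⟨τ', hg, hτ'⟩ := C.glue_eq σ i
  rw [hg] at h
  simp only [Option.some.injEq, Prod.mk.injEq] at h
  obtain ⟨⟨rfl, rfl⟩, rfl⟩ := h
  exact ⟨rfl, rfl, hτ'⟩

/-- A 0-2 vertex move at the ridge between the last and the first simplex extends a cyclic
arrangement. -/
theorem exists_isZeroTwoMove :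
    ∃ U : GenTriangulation d, T.IsZeroTwoMove U ∧ Nonempty (CyclicArrangement U (n + 1)) := by
  obtain ⟨σ, hσ⟩ := (C.exists_index_eq_iff 0).2 (by omega)
  obtain ⟨τ, hτ⟩ := (C.exists_index_eq_iff (2 * n + 1)).2 (by omega)
  have h : T.glue (τ, 0) = some ((σ, 0), 1) := C.glue_of_neighbour (by simp [neighbour, hσ, hτ])
  refine ⟨T.zeroTwoMove _ _ _ h, ⟨_, _, _, h, ⟨⟨Equiv.refl _, fun _ => 1, fun s i => ?_⟩⟩⟩, ⟨⟨
    -- `inr false` is glued to the old last simplex and `inr true` to the first, so in this order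
    -- they prolong the cycle.
    Sum.elim C.index fun b => 2 * n + 2 + b.toNat, ?_, fun k => ?_, ?_⟩⟩⟩
  · simp
  · rintro (s | a) (t | b) hst
    · exact congrArg _ (C.index_injective hst)
    · have := C.index_lt s
      simp at hst
      omega
    · have := C.index_lt t
      simp at hst
      omega
    · cases a <;> cases b <;> first | rfl | simp at hst
  · constructor
    · rintro ⟨s | b, rfl⟩
      · have := C.index_lt s
        simp
        omega
      · cases b <;> simp <;> omega
    · intro hk
      by_cases hk' : k < 2 * n + 2
      · obtain ⟨s, hs⟩ := (C.exists_index_eq_iff k).2 hk'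
        exact ⟨Sum.inl s, hs⟩
      · obtain rfl | rfl : k = 2 * n + 2 ∨ k = 2 * n + 3 := by omega
        exacts [⟨Sum.inr false, rfl⟩, ⟨Sum.inr true, rfl⟩]
  · rintro (s | _ | _) i
    · by_cases h1 : s = τ ∧ i = 0
      · obtain ⟨rfl, rfl⟩ := h1
        refine ⟨Sum.inr false, by simp [zeroTwoMove, zeroTwoGlue], ?_⟩
        simp [neighbour, hτ]
      by_cases h2 : s = σ ∧ i = 0
      · obtain ⟨rfl, rfl⟩ := h2
        have hne : s ≠ τ := by
          rintro rfl
          omega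
        refine ⟨Sum.inr true, by simp [zeroTwoMove, zeroTwoGlue, hne], ?_⟩
        simp [neighbour, hσ]
        omega
      obtain ⟨t, hg, ht⟩ := C.glue_eq s i
      refine ⟨Sum.inl t, by simp [zeroTwoMove, zeroTwoGlue, h1, h2, hg], ?_⟩
      -- On old indices, `neighbour n` and `neighbour (n + 1)` differ only where the cycle used to
      -- close up.
      have e1 : ¬ (C.index s = 2 * n + 1 ∧ i = 0) := fun hs =>
        h1 ⟨C.index_injective (hs.1.trans hτ.symm), hs.2⟩
      have e2 : ¬ (C.index s = 0 ∧ i = 0) := fun hs =>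
        h2 ⟨C.index_injective (hs.1.trans hσ.symm), hs.2⟩
      have := C.index_lt s
      change C.index t = neighbour (n + 1) i (C.index s)
      rw [ht, neighbour, neighbour]
      split_ifs <;> omega
    · by_cases hi : i = 0
      · refine ⟨Sum.inl τ, by simp [zeroTwoMove, zeroTwoGlue, hi], ?_⟩
        simp [neighbour, hi, hτ, parity_simps]
      · refine ⟨Sum.inr true, by simp [zeroTwoMove, zeroTwoGlue, hi], ?_⟩
        simp [neighbour, hi, parity_simps]
    · by_cases hi : i = 0
      · refine ⟨Sum.inl σ, by simp [zeroTwoMove, zeroTwoGlue, hi], ?_⟩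
        simp [neighbour, hi, hσ, parity_simps]
        omega
      · refine ⟨Sum.inr false, by simp [zeroTwoMove, zeroTwoGlue, hi], ?_⟩
        simp [neighbour, hi, parity_simps]

/-! ### Face numbers -/

theorem card_simplex : Nat.card T.Simplex = 2 * n + 2 := by
  have h : Function.Bijective fun σ => (⟨C.index σ, C.index_lt σ⟩ : Fin (2 * n + 2)) := by
    refine ⟨fun σ τ hστ => C.index_injective (congrArg Fin.val hστ), fun k => ?_⟩
    obtain ⟨σ, hσ⟩ := (C.exists_index_eq_iff k).2 k.2
    exact ⟨σ, Fin.ext hσ⟩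
  rw [Nat.card_eq_of_bijective _ h, Nat.card_fin]

omit C in
theorem _root_.GenTriangulation.faceNumber_top (T : GenTriangulation d) :
    T.faceNumber d = Nat.card T.Simplex := by
  let F : T.Simplex → T.Face d := fun σ => Quot.mk _ ⟨σ, ⟨Finset.univ, by simp⟩⟩
  have huniv (s : {s : Finset (Fin (d + 1)) // s.card = d + 1}) : s.1 = Finset.univ :=
    (Finset.card_eq_iff_eq_univ _).1 (by simpa using s.2)
  let G : T.Face d → T.Simplex := Quot.lift Prod.fst (by
    rintro a b ⟨i, j, π, -, hi, -⟩
    simp [huniv] at hi)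
  refine (Nat.card_eq_of_bijective F ⟨fun σ τ h => congrArg G h, ?_⟩).symm
  rintro ⟨σ, s⟩
  obtain rfl : s = ⟨Finset.univ, by simp⟩ := Subtype.ext (huniv s)
  exact ⟨σ, rfl⟩

/-- A vertex of a simplex of a triangulation, as a face. -/
def _root_.GenTriangulation.vertex (T : GenTriangulation d) (σ : T.Simplex) (v : Fin (d + 1)) :
    T.Face 0 :=
  Quot.mk _ ⟨σ, ⟨{v}, rfl⟩⟩

omit C in
theorem _root_.GenTriangulation.exists_eq_vertex (a : T.Face 0) : ∃ σ v, a = T.vertex σ v := by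
  obtain ⟨σ, s, hs⟩ := a
  obtain ⟨v, rfl⟩ := Finset.card_eq_one.1 hs
  exact ⟨σ, v, rfl⟩

theorem vertex_eq {σ τ : T.Simplex} {i v : Fin (d + 1)} (hiv : i ≠ v)
    (h : C.index τ = neighbour n i (C.index σ)) : T.vertex σ v = T.vertex τ v :=
  Quot.sound ⟨i, i, 1, C.glue_of_neighbour h, by simpa using hiv, by ext; simp⟩

/-- The simplices `2 * j` and `2 * j + 1` are glued along the faces opposite to nonzero vertices,
and these contain the vertex `0`. -/
theorem vertex_zero_eq [NeZero d] {σ τ : T.Simplex} (h : C.index σ = 2 * (C.index τ / 2)) :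
    T.vertex τ 0 = T.vertex σ 0 := by
  by_cases he : Even (C.index τ)
  · rw [C.index_injective (a₁ := σ) (a₂ := τ)]
    have := Nat.two_mul_div_two_of_even he
    omega
  · have hi : Fin.succ (0 : Fin d) ≠ 0 := Fin.succ_ne_zero _
    refine C.vertex_eq hi ?_
    rw [neighbour, if_neg hi, if_neg he]
    have := Nat.two_mul_div_two_add_one_of_odd (Nat.not_even_iff_odd.1 he)
    omega

/-- One can walk around the cycle without losing the vertex: the face opposite to `0` always
contains it, and for the other steps a face opposite to a third vertex does. For `d = 1` there is no
third vertex, but in the pillow the face opposite to `0` also serves for the only step. -/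
theorem vertex_succ_eq (hdn : d = 1 → n = 0) (i : Fin d) {σ : T.Simplex} (hσ : C.index σ = 0) :
    ∀ k τ, C.index τ = k → T.vertex τ i.succ = T.vertex σ i.succ := by
  intro k
  induction k with
  | zero => exact fun τ hτ => by rw [C.index_injective (hτ.trans hσ.symm)]
  | succ k ih =>
    intro τ hτ
    have hlt := C.index_lt τ
    obtain ⟨ρ, hρ⟩ := (C.exists_index_eq_iff k).2 (by omega)
    rw [← ih ρ hρ]
    by_cases hk : Even k
    · by_cases hd : d = 1
      · obtain rfl := hdn hd
        refine C.vertex_eq (Fin.succ_ne_zero i).symm ?_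
        simp only [neighbour, if_true]
        split_ifs <;> grind
      · obtain ⟨j, hj⟩ : ∃ j : Fin d, j ≠ i := by
          have : Nontrivial (Fin d) := Fin.nontrivial_iff_two_le.2 (by have := i.2; omega)
          exact exists_ne i
        refine C.vertex_eq (i := j.succ) (by simpa using hj) ?_
        have h' : ¬ Even (k + 1) := by simpa [parity_simps] using hk
        simp [neighbour, hτ, hρ, h']
    · refine C.vertex_eq (Fin.succ_ne_zero i).symm ?_
      have h' : Even (k + 1) := by simpa [parity_simps] using hk
      simp [neighbour, hτ, hρ, h']

theorem faceNumber_zero [NeZero d] (hdn : d = 1 → n = 0) : T.faceNumber 0 = n + 1 + d := by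
  choose s hs using fun k : Fin (2 * n + 2) => (C.exists_index_eq_iff k).2 k.2
  let F : Fin (n + 1) ⊕ Fin d → T.Face 0 := Sum.elim
    (fun j => T.vertex (s ⟨2 * j, by omega⟩) 0) (fun i => T.vertex (s 0) i.succ)
  -- An invariant separating the listed vertices: identity gluings keep the label, and a gluing
  -- across a face containing the vertex `0` stays within a pair `2 * j`, `2 * j + 1`.
  let G : T.Face 0 → Finset (Fin (d + 1)) × ℕ := Quot.lift
    (fun a => (a.2.1, if 0 ∈ a.2.1 then C.index a.1 / 2 else 0)) (by
      rintro ⟨σ, a⟩ ⟨τ, b⟩ ⟨i, j, π, hg, hi, hb⟩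
      obtain ⟨rfl, rfl, hτ⟩ := C.eq_of_glue hg
      have hab : b.1 = a.1 := by
        rw [hb]
        exact Finset.map_refl
      simp only [hab, Prod.mk.injEq, true_and]
      split_ifs with h0
      · have hj : j ≠ 0 := by
          rintro rfl
          exact hi h0
        simp only at hτ
        rw [hτ, neighbour, if_neg hj]
        split_ifs with he <;> grind
      · rfl)
  have hF : Function.Bijective F := by
    constructor
    · refine Function.Injective.of_comp (f := G) ?_
      have hG (σ v) : G (T.vertex σ v) =
          ({v}, if 0 ∈ ({v} : Finset (Fin (d + 1))) then C.index σ / 2 else 0) := rfl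
      rintro (i | i) (j | j) hij
      · simpa [F, hG, hs, Fin.ext_iff] using hij
      · simp [F, hG, (Fin.succ_ne_zero j).symm] at hij
      · simp [F, hG] at hij
      · simpa [F, hG, (Fin.succ_ne_zero _).symm] using hij
    · intro a
      obtain ⟨σ, v, rfl⟩ := exists_eq_vertex a
      cases v using Fin.cases with
      | zero =>
        have := C.index_lt σ
        exact ⟨Sum.inl ⟨C.index σ / 2, by omega⟩, (C.vertex_zero_eq (hs _)).symm⟩
      | succ i => exact ⟨Sum.inr i, (C.vertex_succ_eq hdn i (hs 0) _ σ rfl).symm⟩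
  rw [faceNumber, ← Nat.card_eq_of_bijective F hF]
  simp

end CyclicArrangement

/-! ### A polygonal model of the circle

The cone over a cycle of `2 * n + 2` segments is mapped piecewise linearly onto the cone over a
triangle with vertices `a`, `z` and `b`. A point in the cone over the `k`-th segment is given by
the weight `t` of the start of the segment and the weight `u` of its end, if `k` is even, and with
these roles interchanged if `k` is odd. The segment with index `0` is mapped onto the edge `ab`,
and the others onto the path `azb`. -/

/-- The position along the path formed by the segments with nonzero index. -/
noncomputable def pathPos (k : ℕ) (u t : ℝ) : ℝ :=
  ((k : ℝ) - 1) * (u + t) + if Even k then t else u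

/-- The weight of the vertex `a` of the triangle. -/
noncomputable def weightA (n k : ℕ) (u t : ℝ) : ℝ :=
  if k = 0 then t else max 0 ((u + t) - 2 / (2 * n + 1) * pathPos k u t)

/-- The weight of the vertex `b` of the triangle. -/
noncomputable def weightB (n k : ℕ) (u t : ℝ) : ℝ :=
  if k = 0 then u else max 0 (2 / (2 * n + 1) * pathPos k u t - (u + t))

/-- The weight of the vertex `z` of the triangle. -/
noncomputable def weightZ (n k : ℕ) (u t : ℝ) : ℝ :=
  u + t - weightA n k u t - weightB n k u t

section weights

variable {n k l : ℕ} {u t u' t' : ℝ}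

theorem pathPos_nonneg (hk : k ≠ 0) (hu : 0 ≤ u) (ht : 0 ≤ t) : 0 ≤ pathPos k u t := by
  have : (1 : ℝ) ≤ k := by exact_mod_cast Nat.one_le_iff_ne_zero.2 hk
  have h1 : 0 ≤ ((k : ℝ) - 1) * (u + t) := mul_nonneg (by linarith) (by linarith)
  rw [pathPos]
  split_ifs <;> linarith

theorem pathPos_le (hk : k < 2 * n + 2) (hu : 0 ≤ u) (ht : 0 ≤ t) :
    pathPos k u t ≤ (2 * n + 1) * (u + t) := by
  have : (k : ℝ) ≤ 2 * n + 1 := by exact_mod_cast Nat.le_of_lt_succ hk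
  have h1 : 0 ≤ (2 * n + 1 - (k : ℝ)) * (u + t) := mul_nonneg (by linarith) (by linarith)
  rw [pathPos]
  split_ifs <;> linarith

/-- The factor `2 / (2 * n + 1)` compresses the `2 * n + 1` segments with nonzero index onto the two
edges `az` and `zb`. -/
theorem scaled_pathPos_le (hk : k < 2 * n + 2) (hu : 0 ≤ u) (ht : 0 ≤ t) :
    2 / (2 * n + 1) * pathPos k u t ≤ 2 * (u + t) := by
  have hL : (0 : ℝ) < 2 * n + 1 := by positivity
  have := mul_le_mul_of_nonneg_left (pathPos_le hk hu ht) (div_nonneg zero_le_two hL.le)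
  rwa [← mul_assoc, div_mul_cancel₀ _ hL.ne'] at this

theorem weightA_nonneg (ht : 0 ≤ t) : 0 ≤ weightA n k u t := by
  rw [weightA]
  split_ifs
  exacts [ht, le_max_left _ _]

theorem weightB_nonneg (hu : 0 ≤ u) : 0 ≤ weightB n k u t := by
  rw [weightB]
  split_ifs
  exacts [hu, le_max_left _ _]

theorem weightZ_nonneg (hk : k < 2 * n + 2) (hu : 0 ≤ u) (ht : 0 ≤ t) :
    0 ≤ weightZ n k u t := by
  rw [weightZ, weightA, weightB]
  split_ifs with h
  · linarith
  · have h0 : 0 ≤ 2 / (2 * (n : ℝ) + 1) * pathPos k u t :=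
      mul_nonneg (by positivity) (pathPos_nonneg h hu ht)
    have h1 := scaled_pathPos_le hk hu ht
    rcases max_cases 0 ((u + t) - 2 / (2 * n + 1) * pathPos k u t) with ⟨h2, -⟩ | ⟨h2, -⟩ <;>
    rcases max_cases 0 (2 / (2 * n + 1) * pathPos k u t - (u + t)) with ⟨h3, -⟩ | ⟨h3, -⟩ <;>
    linarith

theorem weight_eq_zero (n k : ℕ) (u t : ℝ) :
    weightA n k u t = 0 ∨ weightZ n k u t = 0 ∨ weightB n k u t = 0 := by
  rw [weightZ, weightA, weightB]
  split_ifs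
  · right; left; ring
  · rcases le_total ((u + t) - 2 / (2 * n + 1) * pathPos k u t) 0 with h | h
    · exact Or.inl (max_eq_left h)
    · exact Or.inr (Or.inr (max_eq_left (by linarith)))

/-- The two maxima are the positive and negative parts of one number; hence the weights determine
the position along the path. -/
theorem weightA_sub_weightB (hk : k ≠ 0) :
    weightA n k u t - weightB n k u t = (u + t) - 2 / (2 * n + 1) * pathPos k u t := by
  rw [weightA, weightB, if_neg hk, if_neg hk]
  rcases max_cases 0 ((u + t) - 2 / (2 * n + 1) * pathPos k u t) with ⟨h2, h⟩ | ⟨h2, h⟩ <;>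
  rcases max_cases 0 (2 / (2 * n + 1) * pathPos k u t - (u + t)) with ⟨h3, h'⟩ | ⟨h3, h'⟩ <;>
  linarith

/-- Weights of points on consecutive segments agree where the segments meet. -/
theorem weight_congr (hkl : l = k + 1) (hut : if Even k then u = 0 else t = 0)
    (hu : 0 ≤ u) (ht : 0 ≤ t) :
    weightA n k u t = weightA n l u t ∧ weightB n k u t = weightB n l u t := by
  subst hkl
  rcases Nat.eq_zero_or_pos k with rfl | hk
  · obtain rfl : u = 0 := by simpa using hut
    simp [weightA, weightB, pathPos, ht]
  · have : pathPos k u t = pathPos (k + 1) u t := by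
      simp only [pathPos, Nat.even_add_one]
      split_ifs at hut ⊢ <;> push_cast <;> rw [hut] <;> ring
    simp [weightA, weightB, this, hk.ne']

/-- Weights agree where the last segment meets the first. -/
theorem weight_congr_last (hu : 0 ≤ u) :
    weightA n (2 * n + 1) u 0 = weightA n 0 u 0 ∧ weightB n (2 * n + 1) u 0 = weightB n 0 u 0 := by
  have h : 2 / (2 * (n : ℝ) + 1) * pathPos (2 * n + 1) u 0 = 2 * u := by
    have : pathPos (2 * n + 1) u 0 = (2 * n + 1) * u := by
      simp [pathPos, parity_simps]
      ring
    rw [this, ← mul_assoc, div_mul_cancel₀ _ (by positivity)]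
  have hA : max 0 (u + 0 - 2 * u) = 0 := max_eq_left (by linarith)
  have hB : max 0 (2 * u - (u + 0)) = u := (max_eq_right (by linarith)).trans (by ring)
  rw [weightA, weightB, if_neg (Nat.succ_ne_zero _), if_neg (Nat.succ_ne_zero _), h, hA, hB]
  exact ⟨(if_pos rfl).symm, (if_pos rfl).symm⟩

/-- The edge `ab` meets the path `azb` only in `a`, where the path begins (`l = 1`), and in `b`,
where it ends (`l = 2 * n + 1`). -/
theorem weight_eq_cases_zero (hl : l < 2 * n + 2) (hl0 : l ≠ 0) (hu' : 0 ≤ u') (ht' : 0 ≤ t')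
    (hc : u + t = u' + t') (hc0 : 0 < u + t)
    (hA : weightA n 0 u t = weightA n l u' t') (hB : weightB n 0 u t = weightB n l u' t') :
    (l = 1 ∧ u = 0 ∧ u' = 0) ∨ (l = 2 * n + 1 ∧ t = 0 ∧ t' = 0) := by
  have hL : (0 : ℝ) < 2 * n + 1 := by positivity
  have hl1 : (1 : ℝ) ≤ l := by exact_mod_cast Nat.one_le_iff_ne_zero.2 hl0
  have hlL : (l : ℝ) ≤ 2 * n + 1 := by exact_mod_cast Nat.le_of_lt_succ hl
  have hAB := weightA_sub_weightB (n := n) (u := u') (t := t') hl0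
  have hA0 : weightA n 0 u t = t := if_pos rfl
  have hB0 : weightB n 0 u t = u := if_pos rfl
  have hor : t = 0 ∨ u = 0 := by
    rw [hA0.symm.trans hA, hB0.symm.trans hB, weightA, weightB, if_neg hl0, if_neg hl0]
    rcases le_total ((u' + t') - 2 / (2 * n + 1) * pathPos l u' t') 0 with h | h
    · exact Or.inl (max_eq_left h)
    · exact Or.inr (max_eq_left (by linarith))
  rw [← hA, ← hB, hA0, hB0] at hAB
  have hP : 2 * pathPos l u' t' = (2 * n + 1) * (2 * u) := by
    have : 2 / (2 * (n : ℝ) + 1) * pathPos l u' t' = 2 * u := by linarith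
    rw [← this]
    field_simp
  rcases hor with rfl | rfl
  · right
    have h1 : l = 2 * n + 1 := by
      by_contra hne
      have : (l : ℝ) ≤ 2 * n := by exact_mod_cast (by omega : l ≤ 2 * n)
      have h2 : ((l : ℝ) - 1) * (u' + t') ≤ (2 * n - 1) * (u' + t') :=
        mul_le_mul_of_nonneg_right (by linarith) (by linarith)
      rw [pathPos] at hP
      split_ifs at hP <;> nlinarith
    refine ⟨h1, rfl, ?_⟩
    have : ¬ Even l := by rw [h1]; simp [parity_simps]
    rw [pathPos, if_neg this, h1] at hP
    push_cast at hP
    nlinarith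
  · left
    have h0 := mul_nonneg (sub_nonneg.2 hl1) (add_nonneg hu' ht')
    have h1 : l = 1 := by
      by_contra hne
      have : (2 : ℝ) ≤ l := by exact_mod_cast (by omega : 2 ≤ l)
      have h2 : 1 * (u' + t') ≤ ((l : ℝ) - 1) * (u' + t') :=
        mul_le_mul_of_nonneg_right (by linarith) (by linarith)
      rw [pathPos] at hP
      split_ifs at hP <;> linarith
    refine ⟨h1, rfl, ?_⟩
    rw [pathPos, h1] at hP
    simpa using hP

/-- Equal weights force equal positions, and the `k`-th segment covers the positions from `k - 1` to
`k` in units of `u + t`; two distinct segments can then share only a common endpoint. -/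
theorem weight_eq_cases_pos (hk : k ≠ 0) (hkl : k ≤ l)
    (hu : 0 ≤ u) (ht : 0 ≤ t) (hu' : 0 ≤ u') (ht' : 0 ≤ t')
    (hc : u + t = u' + t') (hc0 : 0 < u + t)
    (hA : weightA n k u t = weightA n l u' t') (hB : weightB n k u t = weightB n l u' t') :
    (k = l ∧ u = u') ∨
      (l = k + 1 ∧ u = u' ∧ if Even k then u = 0 else t = 0) := by
  have hL : (0 : ℝ) < 2 / (2 * n + 1) := by positivity
  have hP : pathPos k u t = pathPos l u' t' := by
    have h1 := weightA_sub_weightB (n := n) (u := u) (t := t) hk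
    have h2 := weightA_sub_weightB (n := n) (u := u') (t := t') (by omega : l ≠ 0)
    exact mul_left_cancel₀ hL.ne' (by linarith)
  rw [pathPos, pathPos, ← hc] at hP
  rcases hkl.eq_or_lt with rfl | hlt
  · left
    refine ⟨rfl, ?_⟩
    split_ifs at hP <;> linarith
  · right
    have h1 : l = k + 1 := by
      by_contra hne
      have : (k : ℝ) + 2 ≤ l := by exact_mod_cast (by omega : k + 2 ≤ l)
      have h2 : ((k : ℝ) + 1) * (u + t) ≤ ((l : ℝ) - 1) * (u + t) :=
        mul_le_mul_of_nonneg_right (by linarith) (by linarith)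
      split_ifs at hP <;> nlinarith
    refine ⟨h1, ?_⟩
    subst h1
    simp only [Nat.even_add_one] at hP
    push_cast at hP
    split_ifs at hP ⊢ <;> constructor <;> linarith

/-- Every point in the cone over the path `azb` is in the image of the cone over a segment. -/
theorem exists_weight_eq (n : ℕ) {A B Z : ℝ} (hA : 0 ≤ A) (hB : 0 ≤ B) (hZ : 0 < Z)
    (hAB : A = 0 ∨ B = 0) :
    ∃ k < 2 * n + 2, ∃ u t, 0 ≤ u ∧ 0 ≤ t ∧ u + t = A + B + Z ∧
      weightA n k u t = A ∧ weightB n k u t = B := by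
  set c := A + B + Z with hcdef
  have hL : (0 : ℝ) < 2 * n + 1 := by positivity
  have hc : 0 < c := by linarith
  -- This solves `weightA_sub_weightB` for the position; its integer part in units of `c` selects
  -- the segment.
  set P : ℝ := (2 * n + 1) * (c - (A - B)) / 2 with hP
  have hP0 : 0 ≤ P := div_nonneg (mul_nonneg hL.le (by linarith)) zero_le_two
  -- Strictness comes from `0 < Z`, which excludes `b`; otherwise the floor could point past the
  -- last segment.
  have hPL : P < (2 * n + 1) * c := by
    have : (2 * n + 1) * (c - (A - B)) < (2 * n + 1) * (2 * c) :=
      mul_lt_mul_of_pos_left (by linarith) hL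
    linarith
  set m := ⌊P / c⌋₊
  have hm : (m : ℝ) * c ≤ P := (le_div_iff₀ hc).1 (Nat.floor_le (div_nonneg hP0 hc.le))
  have hm' : P < (m + 1) * c := (div_lt_iff₀ hc).1 (Nat.lt_floor_add_one _)
  have hmL : m < 2 * n + 1 := by
    have : (m : ℝ) < 2 * n + 1 := lt_of_mul_lt_mul_right (hm.trans_lt hPL) hc.le
    exact_mod_cast this
  set p := P - m * c with hp
  have key : ∃ u t, 0 ≤ u ∧ 0 ≤ t ∧ u + t = c ∧ pathPos (m + 1) u t = P := by
    by_cases he : Even (m + 1)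
    · refine ⟨c - p, p, by linarith, by linarith, by ring, ?_⟩
      rw [pathPos, if_pos he]
      push_cast
      rw [hp]
      ring
    · refine ⟨p, c - p, by linarith, by linarith, by ring, ?_⟩
      rw [pathPos, if_neg he]
      push_cast
      rw [hp]
      ring
  obtain ⟨u, t, hu, ht, hut, hpos⟩ := key
  refine ⟨m + 1, by omega, u, t, hu, ht, hut, ?_⟩
  have hscale : 2 / (2 * n + 1) * P = c - (A - B) := by
    rw [hP]
    field_simp
  rw [weightA, weightB, if_neg (Nat.succ_ne_zero m), if_neg (Nat.succ_ne_zero m), hpos, hut, hscale]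
  rcases hAB with rfl | rfl
  · exact ⟨max_eq_left (by linarith), (max_eq_right (by linarith)).trans (by linarith)⟩
  · exact ⟨(max_eq_right (by linarith)).trans (by linarith), max_eq_left (by linarith)⟩

end weights

/-! ### Cyclic arrangements are spheres -/

section spherePoint

variable [NeZero d] {n k l : ℕ} {x y : Fin (d + 1) → ℝ}

/-- The least barycentric coordinate of a point with respect to the vertices other than `0`. -/
noncomputable def low (x : Fin (d + 1) → ℝ) : ℝ :=
  least fun i : Fin d => x i.succ

/-- The map from the `k`-th simplex of a cyclic arrangement to the boundary of the simplex: the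
join of the identity of the boundary of the face opposite to the vertex `0` and the polygonal map
described above. -/
noncomputable def spherePoint (n k : ℕ) (x : Fin (d + 1) → ℝ) : Fin (d + 2) → ℝ :=
  Fin.cons (weightA n k (d * low x) (x 0)) (Fin.cons (weightZ n k (d * low x) (x 0))
    fun i : Fin d => x i.succ - low x + 1 / d * weightB n k (d * low x) (x 0))

theorem low_nonneg (hx : x ∈ stdSimplex ℝ (Fin (d + 1))) : 0 ≤ low x := by
  obtain ⟨i, hi⟩ := exists_eq_least fun i : Fin d => x i.succ
  exact (hx.1 i.succ).trans hi.le

theorem mul_low_nonneg (hx : x ∈ stdSimplex ℝ (Fin (d + 1))) : 0 ≤ d * low x :=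
  mul_nonneg (Nat.cast_nonneg d) (low_nonneg hx)

theorem low_eq_zero (hx : x ∈ stdSimplex ℝ (Fin (d + 1))) {i : Fin (d + 1)} (hi : i ≠ 0)
    (hxi : x i = 0) : low x = 0 := by
  obtain ⟨j, rfl⟩ := Fin.exists_succ_eq.2 hi
  exact least_eq (fun i => hx.1 i.succ) j hxi

theorem spherePoint_mem (hk : k < 2 * n + 2) (hx : x ∈ stdSimplex ℝ (Fin (d + 1))) :
    spherePoint n k x ∈ simplexBoundary d := by
  have hd : (0 : ℝ) < d := Nat.cast_pos.2 (NeZero.pos d)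
  have hu := mul_low_nonneg hx
  have ht := hx.1 0
  refine ⟨⟨fun i => ?_, ?_⟩, ?_⟩
  · cases i using Fin.cases with
    | zero => exact weightA_nonneg ht
    | succ i =>
      cases i using Fin.cases with
      | zero => exact weightZ_nonneg hk hu ht
      | succ i =>
        exact add_nonneg (sub_nonneg.2 (least_le (fun i : Fin d => x i.succ) i))
          (mul_nonneg (by positivity) (weightB_nonneg hu))
  · have h := hx.2
    rw [Fin.sum_univ_succ] at h
    simp only [spherePoint, Fin.sum_univ_succ, Fin.cons_zero, Fin.cons_succ,
      Finset.sum_add_distrib, Finset.sum_sub_distrib, Finset.sum_const, Finset.card_univ,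
      Fintype.card_fin, nsmul_eq_mul, weightZ]
    field_simp
    linarith
  · rcases weight_eq_zero n k (d * low x) (x 0) with h | h | h
    · exact ⟨0, h⟩
    · exact ⟨1, h⟩
    · obtain ⟨i, hi⟩ := exists_eq_least fun i : Fin d => x i.succ
      refine ⟨i.succ.succ, ?_⟩
      change x i.succ - low x + 1 / d * weightB n k (d * low x) (x 0) = 0
      rw [h, hi, low, sub_self, mul_zero, add_zero]

theorem isPiecewiseLinear_spherePoint (n k : ℕ) :
    IsPiecewiseLinear fun x : stdSimplex ℝ (Fin (d + 1)) => spherePoint n k x.1 := by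
  have hl : IsPLFun fun x : stdSimplex ℝ (Fin (d + 1)) => low x.1 :=
    .inf' Finset.univ_nonempty fun i : Fin d => .coord i.succ
  have hu := hl.const_mul d
  have ht : IsPLFun fun x : stdSimplex ℝ (Fin (d + 1)) => x.1 0 := .coord 0
  have hP : IsPLFun fun x : stdSimplex ℝ (Fin (d + 1)) => pathPos k (d * low x.1) (x.1 0) := by
    unfold pathPos
    split_ifs
    exacts [((hu.add ht).const_mul _).add ht, ((hu.add ht).const_mul _).add hu]
  have hA : IsPLFun fun x : stdSimplex ℝ (Fin (d + 1)) =>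
      weightA n k (d * low x.1) (x.1 0) := by
    unfold weightA
    split_ifs
    exacts [ht, IsPLFun.zero.max ((hu.add ht).sub (hP.const_mul _))]
  have hB : IsPLFun fun x : stdSimplex ℝ (Fin (d + 1)) =>
      weightB n k (d * low x.1) (x.1 0) := by
    unfold weightB
    split_ifs
    exacts [hu, IsPLFun.zero.max ((hP.const_mul _).sub (hu.add ht))]
  refine IsPLFun.isPiecewiseLinear fun j => ?_
  cases j using Fin.cases with
  | zero => exact hA
  | succ j =>
    cases j using Fin.cases with
    | zero => exact ((hu.add ht).sub hA).sub hB
    | succ i => exact ((IsPLFun.coord i.succ).sub hl).add (hB.const_mul _)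

theorem spherePoint_congr (hA : weightA n k (d * low x) (x 0) = weightA n l (d * low x) (x 0))
    (hB : weightB n k (d * low x) (x 0) = weightB n l (d * low x) (x 0)) :
    spherePoint n k x = spherePoint n l x := by
  rw [spherePoint, spherePoint, weightZ, weightZ, hA, hB]

theorem spherePoint_neighbour (hk : k < 2 * n + 2) (hx : x ∈ stdSimplex ℝ (Fin (d + 1)))
    {i : Fin (d + 1)} (hxi : x i = 0) :
    spherePoint n (neighbour n i k) x = spherePoint n k x := by
  have hu := mul_low_nonneg hx
  have ht := hx.1 0
  have step {k l : ℕ} (hkl : l = k + 1)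
      (h : if Even k then (d : ℝ) * low x = 0 else x 0 = 0) :
      spherePoint n l x = spherePoint n k x := by
    obtain ⟨hA, hB⟩ := weight_congr (n := n) hkl h hu ht
    exact (spherePoint_congr hA hB).symm
  have last (h : x 0 = 0) : spherePoint n (2 * n + 1) x = spherePoint n 0 x := by
    obtain ⟨hA, hB⟩ := weight_congr_last (n := n) hu
    exact spherePoint_congr (by rwa [h]) (by rwa [h])
  rw [neighbour]
  split_ifs with hi he h0 hl he
  · subst hi h0
    exact last hxi
  · subst hi
    have : ¬ Even (k - 1) := by grind
    exact (step (by omega) (by rwa [if_neg this])).symm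
  · subst hi hl
    exact (last hxi).symm
  · subst hi
    exact step rfl (by rwa [if_neg he])
  · exact step rfl (by rw [if_pos he, low_eq_zero hx hi hxi, mul_zero])
  · have : Even (k - 1) := by grind
    exact (step (by grind) (by rw [if_pos this, low_eq_zero hx hi hxi, mul_zero])).symm

/-- The `∂Δ^(d-1)` part has least entry zero, so the weight of `b` can be read off from the image.
-/
theorem low_spherePoint (n k : ℕ) (x : Fin (d + 1) → ℝ) :
    least (fun i : Fin d => spherePoint n k x i.succ.succ) =
      1 / d * weightB n k (d * low x) (x 0) := by
  have := least_sub_add (fun i : Fin d => x i.succ) (low x)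
    (1 / d * weightB n k (d * low x) (x 0))
  rw [← low, sub_self, zero_add] at this
  exact this

/-- The image determines the join coordinates in the target. The total `u + t` and the `∂Δ^(d-1)`
part are preserved by the map, so only `u` remains to be recovered. -/
theorem weights_eq_of_spherePoint_eq (h : spherePoint n k x = spherePoint n l y) :
    weightA n k (d * low x) (x 0) = weightA n l (d * low y) (y 0) ∧
    weightB n k (d * low x) (x 0) = weightB n l (d * low y) (y 0) ∧
    d * low x + x 0 = d * low y + y 0 ∧
    (d * low x = d * low y → x = y) := by
  have hd : (0 : ℝ) < 1 / d := one_div_pos.2 (Nat.cast_pos.2 (NeZero.pos d))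
  have hA : weightA n k (d * low x) (x 0) = weightA n l (d * low y) (y 0) := congrFun h 0
  have hZ : weightZ n k (d * low x) (x 0) = weightZ n l (d * low y) (y 0) := congrFun h 1
  have hB : weightB n k (d * low x) (x 0) = weightB n l (d * low y) (y 0) :=
    mul_left_cancel₀ hd.ne' (by rw [← low_spherePoint, h, low_spherePoint])
  have hc : d * low x + x 0 = d * low y + y 0 := by
    rw [weightZ, weightZ] at hZ
    linarith
  refine ⟨hA, hB, hc, fun hu => ?_⟩
  have hlow : low x = low y := mul_left_cancel₀ (one_div_pos.1 hd).ne' hu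
  ext i
  cases i using Fin.cases with
  | zero => linarith
  | succ i =>
    have hi : x i.succ - low x + 1 / d * weightB n k (d * low x) (x 0) =
      y i.succ - low y + 1 / d * weightB n l (d * low y) (y 0) := congrFun h i.succ.succ
    rw [hB, hlow] at hi
    linarith

theorem exists_spherePoint_eq {z : Fin (d + 2) → ℝ} (hz : z ∈ simplexBoundary d) (n : ℕ) :
    ∃ k < 2 * n + 2, ∃ x ∈ stdSimplex ℝ (Fin (d + 1)), spherePoint n k x = z := by
  obtain ⟨⟨hz0, hz1⟩, i, hi⟩ := hz
  have hd : (0 : ℝ) < d := Nat.cast_pos.2 (NeZero.pos d)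
  set w : Fin d → ℝ := fun i => z i.succ.succ with hw
  obtain ⟨j, hj⟩ := exists_eq_least w
  have hB0 : 0 ≤ d * least w := mul_nonneg hd.le (hj ▸ hz0 _)
  obtain ⟨k, hk, u, t, hu, ht, hut, hA, hB⟩ : ∃ k < 2 * n + 2, ∃ u t, 0 ≤ u ∧ 0 ≤ t ∧
      u + t = z 0 + d * least w + z 1 ∧ weightA n k u t = z 0 ∧
      weightB n k u t = d * least w := by
    -- Points with zero weight at `z` lie over the edge `ab`, which is the image of segment `0`; the
    -- others lie over the path.
    rcases (hz0 1).eq_or_lt with h1 | h1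
    · exact ⟨0, by omega, d * least w, z 0, hB0, hz0 0, by rw [← h1]; ring, by simp [weightA],
        by simp [weightB]⟩
    · refine exists_weight_eq n (hz0 0) hB0 h1 ?_
      cases i using Fin.cases with
      | zero => exact Or.inl hi
      | succ i =>
        cases i using Fin.cases with
        | zero => exact absurd hi h1.ne'
        | succ i => exact Or.inr (by rw [least_eq (fun i => hz0 i.succ.succ) i hi, mul_zero])
  have hlow : low (Fin.cons t fun i => w i - least w + u / d : Fin (d + 1) → ℝ) = u / d := by
    have := least_sub_add w (least w) (u / d)
    rw [sub_self, zero_add] at this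
    simpa [low] using this
  have hdlow : d * low (Fin.cons t fun i => w i - least w + u / d : Fin (d + 1) → ℝ) = u := by
    rw [hlow]
    field_simp
  -- The `∂Δ^(d-1)` part of the target point is kept, and the weight `u` is spread evenly over the
  -- `d` nonzero vertices.
  refine ⟨k, hk, Fin.cons t fun i => w i - least w + u / d, ⟨fun i => ?_, ?_⟩, ?_⟩
  · cases i using Fin.cases with
    | zero => exact ht
    | succ i =>
      exact add_nonneg (sub_nonneg.2 (least_le w i)) (div_nonneg hu hd.le)
  · rw [Fin.sum_univ_succ, Fin.sum_univ_succ] at hz1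
    simp only [Fin.sum_univ_succ, Fin.cons_zero, Fin.cons_succ,
      Finset.sum_add_distrib, Finset.sum_sub_distrib, Finset.sum_const, Finset.card_univ,
      Fintype.card_fin, nsmul_eq_mul]
    have h1 : z (Fin.succ 0) = z 1 := rfl
    rw [h1] at hz1
    field_simp
    linarith
  · have hZ : weightZ n k u t = z 1 := by
      rw [weightZ, hA, hB, hut]
      ring
    rw [spherePoint, hdlow, Fin.cons_zero, hA, hB, hZ]
    ext i
    cases i using Fin.cases with
    | zero => rfl
    | succ i =>
      cases i using Fin.cases with
      | zero => rfl
      | succ i =>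
        simp only [Fin.cons_succ, hlow]
        field_simp
        rw [hw]
        ring

end spherePoint

namespace CyclicArrangement

variable {T : GenTriangulation d} {n : ℕ} (C : CyclicArrangement T n)

include C

theorem charMap_eq_of_neighbour {σ τ : T.Simplex} {i : Fin (d + 1)}
    {x : stdSimplex ℝ (Fin (d + 1))} (hxi : x.1 i = 0)
    (h : C.index τ = neighbour n i (C.index σ)) : T.charMap σ x = T.charMap τ x :=
  Quot.sound ⟨i, i, 1, C.glue_of_neighbour h, hxi, fun _ => rfl⟩

variable [NeZero d]

theorem charMap_eq_of_succ {σ τ : T.Simplex} {x : stdSimplex ℝ (Fin (d + 1))}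
    (h : C.index τ = C.index σ + 1) (hx : if Even (C.index σ) then low x.1 = 0 else x.1 0 = 0) :
    T.charMap σ x = T.charMap τ x := by
  split_ifs at hx with he
  · obtain ⟨i, hi⟩ := exists_eq_least fun i : Fin d => x.1 i.succ
    exact C.charMap_eq_of_neighbour (hi.trans hx) (by simp [neighbour, he, h])
  · have := C.index_lt τ
    refine C.charMap_eq_of_neighbour hx ?_
    rw [neighbour, if_pos rfl, if_neg he, if_neg (by omega), h]

/-- Such a point lies in the factor `∂Δ^(d-1)`, hence in every face shared by consecutive simplices
or in one of several such faces, and can be carried around the whole cycle. -/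
theorem charMap_eq_of_zero {σ τ : T.Simplex} {x : stdSimplex ℝ (Fin (d + 1))}
    (h0 : x.1 0 = 0) (hlow : low x.1 = 0) : T.charMap σ x = T.charMap τ x := by
  obtain ⟨ρ, hρ⟩ := (C.exists_index_eq_iff 0).2 (by omega)
  have key : ∀ k σ, C.index σ = k → T.charMap ρ x = T.charMap σ x := by
    intro k
    induction k with
    | zero => exact fun σ hσ => by rw [C.index_injective (hσ.trans hρ.symm)]
    | succ k ih =>
      intro σ hσ
      have := C.index_lt σ
      obtain ⟨τ, hτ⟩ := (C.exists_index_eq_iff k).2 (by omega)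
      rw [ih τ hτ]
      exact C.charMap_eq_of_succ (by rw [hσ, hτ]) (by split_ifs <;> assumption)
  rw [← key _ σ rfl, key _ τ rfl]

theorem charMap_eq_of_spherePoint_eq {σ τ : T.Simplex} {x y : stdSimplex ℝ (Fin (d + 1))}
    (h : spherePoint n (C.index σ) x.1 = spherePoint n (C.index τ) y.1) :
    T.charMap σ x = T.charMap τ y := by
  wlog hle : C.index σ ≤ C.index τ generalizing σ τ x y
  · exact (this h.symm (le_of_not_ge hle)).symm
  have hd : (d : ℝ) ≠ 0 := Nat.cast_ne_zero.2 (NeZero.ne d)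
  obtain ⟨hA, hB, hc, hxy⟩ := weights_eq_of_spherePoint_eq h
  have hu := mul_low_nonneg x.2
  have hu' := mul_low_nonneg y.2
  have ht := x.2.1 0
  have ht' := y.2.1 0
  have hxy' := fun hu => Subtype.ext (hxy hu)
  -- If `u + t = 0`, the polygon coordinate is meaningless and the index cannot be recovered, but
  -- all simplices share the point.
  rcases (add_nonneg hu ht).eq_or_lt with hc0 | hc0
  · obtain rfl := hxy' (by linarith)
    exact C.charMap_eq_of_zero (by linarith)
      ((mul_eq_zero.1 (by linarith : (d : ℝ) * low x.1 = 0)).resolve_left hd)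
  by_cases hσ : C.index σ = 0
  · by_cases hτ : C.index τ = 0
    · rw [hσ, hτ] at hB
      obtain rfl := hxy' hB
      rw [C.index_injective (hσ.trans hτ.symm)]
    · rw [hσ] at hA hB
      rcases weight_eq_cases_zero (C.index_lt τ) hτ hu' ht' hc hc0 hA hB with
        ⟨h1, h2, h3⟩ | ⟨h1, h2, h3⟩
      · obtain rfl := hxy' (h2.trans h3.symm)
        refine C.charMap_eq_of_succ (by omega) ?_
        rw [hσ, if_pos Even.zero]
        exact (mul_eq_zero.1 h2).resolve_left hd
      · obtain rfl := hxy' (by linarith)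
        refine C.charMap_eq_of_neighbour h2 ?_
        simp [neighbour, hσ, h1]
  · rcases weight_eq_cases_pos hσ hle hu ht hu' ht' hc hc0 hA hB with ⟨h1, h2⟩ | ⟨h1, h2, h3⟩
    · obtain rfl := hxy' h2
      rw [C.index_injective h1]
    · obtain rfl := hxy' h2
      refine C.charMap_eq_of_succ h1 ?_
      split_ifs at h3 ⊢
      exacts [(mul_eq_zero.1 h3).resolve_left hd, h3]

/-- The underlying space of a cyclic arrangement is mapped to the boundary of the simplex. -/
noncomputable def toBoundary : T.Space → simplexBoundary d :=
  Quot.lift (fun p => ⟨spherePoint n (C.index p.1) p.2.1, spherePoint_mem (C.index_lt _) p.2.2⟩)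
    (by
      rintro ⟨σ, x⟩ ⟨τ, y⟩ ⟨i, j, π, hg, hxi, hy⟩
      obtain ⟨rfl, rfl, hτ⟩ := C.eq_of_glue hg
      obtain rfl : y = x := Subtype.ext (funext hy)
      exact Subtype.ext (by simp only [hτ, spherePoint_neighbour (C.index_lt σ) y.2 hxi]))

theorem continuous_toBoundary : Continuous C.toBoundary := by
  refine continuous_quot_lift _ (continuous_sigma fun σ => ?_)
  exact (isPiecewiseLinear_spherePoint n (C.index σ)).1.subtype_mk _

theorem toBoundary_bijective : Function.Bijective C.toBoundary := by
  constructor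
  · rintro ⟨σ, x⟩ ⟨τ, y⟩ h
    exact C.charMap_eq_of_spherePoint_eq (congrArg Subtype.val h)
  · rintro ⟨z, hz⟩
    obtain ⟨k, hk, x, hx, h⟩ := exists_spherePoint_eq hz n
    obtain ⟨σ, rfl⟩ := (C.exists_index_eq_iff k).2 hk
    exact ⟨T.charMap σ ⟨x, hx⟩, Subtype.ext h⟩

theorem isPLSphere : T.IsPLSphere := by
  have : CompactSpace T.Space :=
    inferInstanceAs (CompactSpace (Quot T.PointGlued))
  exact ⟨Continuous.homeoOfEquivCompactToT2 (f := Equiv.ofBijective _ C.toBoundary_bijective)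
    C.continuous_toBoundary, fun σ => isPiecewiseLinear_spherePoint n (C.index σ)⟩

theorem triangulatesSphere : T.TriangulatesSphere := by
  obtain ⟨h, hPL⟩ := C.isPLSphere
  obtain ⟨g⟩ := nonempty_homeomorph_simplexBoundary_sphere d
  exact ⟨⟨h.trans g⟩, h, hPL⟩

end CyclicArrangement

/-- Finitely many 0-2 vertex moves on the pillow lead to cyclic arrangements of any even length. -/
theorem exists_cyclicArrangement (d n : ℕ) :
    ∃ T : GenTriangulation d, Nonempty (CyclicArrangement T n) ∧
      Relation.ReflTransGen IsZeroTwoMove (pillow d) T := by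
  induction n with
  | zero => exact ⟨pillow d, ⟨.pillow d⟩, .refl⟩
  | succ n ih =>
    obtain ⟨T, ⟨C⟩, hT⟩ := ih
    obtain ⟨U, hTU, hU⟩ := C.exists_isZeroTwoMove
    exact ⟨U, hU, hT.tail hTU⟩

end GenTriangulation

theorem mainTheorem7 (d f : ℕ) (hd : 0 < d) (hf : 0 < f) (heven : Even f)
    (hcircle : d = 1 → f = 2) :
    ∃ T : GenTriangulation d,
      T.TriangulatesSphere ∧
      T.faceNumber d = f ∧
      T.faceNumber 0 = f / 2 + d ∧
      Relation.ReflTransGen GenTriangulation.IsZeroTwoMove (GenTriangulation.pillow d) T := by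
  have : NeZero d := ⟨hd.ne'⟩
  obtain ⟨n, rfl⟩ : ∃ n, f = 2 * n + 2 := ⟨f / 2 - 1, by grind⟩
  obtain ⟨T, ⟨C⟩, hT⟩ := GenTriangulation.exists_cyclicArrangement d n
  refine ⟨T, C.triangulatesSphere, T.faceNumber_top.trans C.card_simplex, ?_, hT⟩
  rw [C.faceNumber_zero fun h => by have := hcircle h; omega]
  omega
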